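/- For a real square matrix $A$ let $\|A\|$ denote its spectral norm, and let $A\circ B$ denote the entrywise product of matrices of the same size. For $i\in[n]$ let $D_i$ be the $2^n\times 2^n$ matrix indexed by $\{0,1\}^n$ with $D_i(x,y)=1$ if $x_i\neq y_i$ and $D_i(x,y)=0$ otherwise. For a Boolean function $g:\{0,1\}^n\to\{0,1\}$ let $$\mathrm{ADV}^{\pm}(g)=\max_{\Gamma}\ \|\Gamma\|,$$ the maximum being over all real $2^n\times 2^n$ matrices $\Gamma$ with $\|\Gamma\circ D_i\|\le 1$ for all $i\in[n]$ and $\Gamma(x,y)=0$ for all $x,y\in\{0,1\}^n$ with $g(x)=g(y)$. For a relation $f\subseteq\{0,1\}^n\times[K]$ such that every $x\in\{0,1\}^n$ has some $a\in[K]$ with $(x,a)\in f$, let $$\mathrm{ADV}_{rel}^{\pm}(f)=\min_{\{u_{x,i}\},\{v_{x,i}\},\{\sigma_{x,a}\}}\ \max\Big\{\max_{x}\sum_{i\in[n]}\|u_{x,i}\|^2,\ \max_{x}\sum_{i\in[n]}\|v_{x,i}\|^2\Big\},$$ the minimum being over all families of real vectors $u_{x,i},v_{x,i},\sigma_{x,a}$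 ($x\in\{0,1\}^n$, $i\in[n]$, $a\in[K]$) of arbitrary finite dimension such that $$\sum_{i:\,x_i\ne y_i}\langle u_{x,i},v_{y,i}\rangle=1-\sum_{a\in[K]}\langle\sigma_{x,a},\sigma_{y,a}\rangle\quad\text{for all }x,y\in\{0,1\}^n,$$ and $\|\sigma_{x,a}\|^2=0$ for all $x,a$ with $(x,a)\notin f$. **Theorem.** Let $f\subseteq\{0,1\}^N\times[K]$ be a relation such that for every $x\in\{0,1\}^N$ there is $a\in[K]$ with $(x,a)\in f$, and let $g:\{0,1\}^m\to\{0,1\}$ be a Boolean function. Let $f\circ g^N\subseteq\{0,1\}^{Nm}\times[K]$ be the relation consisting of all pairs $((x_1,\ldots,x_N),a)$, with each $x_p\in\{0,1\}^m$, such that $((g(x_1),\ldots,g(x_N)),a)\in f$. Then $$\mathrm{ADV}_{rel}^{\pm}(f\circ g^N)\ \ge\ \mathrm{ADV}_{rel}^{\pm}(f)\cdot\mathrm{ADV}^{\pm}(g).$$ -/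

import Mathlib

namespace RelAdv

noncomputable section

/-- Bit strings of length `n`. -/
abbrev Cube (n : ℕ) : Type := Fin n → Bool

/-- The spectral norm of a real square matrix: the operator norm with respect to the
Euclidean norm. -/
def specNorm {ι : Type*} [Fintype ι] [DecidableEq ι] (A : Matrix ι ι ℝ) : ℝ :=
  ‖Matrix.toEuclideanCLM (𝕜 := ℝ) A‖

/-- The Boolean matrix `D i`, with `D i x y = 1` iff `x i ≠ y i`. -/
def diffMatrix {n : ℕ} (i : Fin n) : Matrix (Cube n) (Cube n) ℝ :=
  Matrix.of fun x y => if x i ≠ y i then 1 else 0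

/-- The constraints of the functional adversary bound of `g`. -/
structure IsAdvFeasible {n : ℕ} (g : Cube n → Bool) (Γ : Matrix (Cube n) (Cube n) ℝ) :
    Prop where
  norm_le : ∀ i, specNorm (Matrix.hadamard Γ (diffMatrix i)) ≤ 1
  eq_zero : ∀ x y, g x = g y → Γ x y = 0

/-- The functional (negative weight) adversary bound of a Boolean function: the largest
spectral norm of a feasible matrix. -/
def adv {n : ℕ} (g : Cube n → Bool) : ℝ :=
  sSup {r | ∃ Γ : Matrix (Cube n) (Cube n) ℝ, IsAdvFeasible g Γ ∧ r = specNorm Γ}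

/-- The constraints of the relational adversary bound of `f`, for vectors `u x i`, `v x i`
in `ℝ ^ d` and vectors `σ x a` in `ℝ ^ e`. -/
structure IsRelFeasible {n K : ℕ} (f : Set (Cube n × Fin K)) {d e : ℕ}
    (u v : Cube n → Fin n → EuclideanSpace ℝ (Fin d))
    (σ : Cube n → Fin K → EuclideanSpace ℝ (Fin e)) : Prop where
  sum_eq : ∀ x y, ∑ i with x i ≠ y i, inner ℝ (u x i) (v y i) =
    1 - ∑ a, inner ℝ (σ x a) (σ y a)
  norm_sq_eq_zero : ∀ x a, (x, a) ∉ f → ‖σ x a‖ ^ 2 = 0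

/-- The objective value of the vectors `u x i`, `v x i`. -/
def relCost {n d : ℕ} (u v : Cube n → Fin n → EuclideanSpace ℝ (Fin d)) : ℝ :=
  max (⨆ x, ∑ i, ‖u x i‖ ^ 2) (⨆ x, ∑ i, ‖v x i‖ ^ 2)

/-- The relational adversary bound of a relation: the smallest objective value of feasible
families of vectors, of arbitrary finite dimensions. -/
def advRel {n K : ℕ} (f : Set (Cube n × Fin K)) : ℝ :=
  sInf {r | ∃ (d e : ℕ) (u v : Cube n → Fin n → EuclideanSpace ℝ (Fin d))
    (σ : Cube n → Fin K → EuclideanSpace ℝ (Fin e)),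
    IsRelFeasible f u v σ ∧ r = relCost u v}

/-- The `p`-th block, of length `m`, of a string of length `N * m`; its `q`-th bit is the
bit number `p * m + q` of the string (all indices counted from `0`). -/
def block {N m : ℕ} (x : Cube (N * m)) (p : Fin N) : Cube m :=
  fun q => x (finProdFinEquiv (p, q))

/-- The composed relation `f ∘ g ^ N`. -/
def compRel {N K m : ℕ} (f : Set (Cube N × Fin K)) (g : Cube m → Bool) :
    Set (Cube (N * m) × Fin K) :=
  {xa | ((fun p => g (block xa.1 p)), xa.2) ∈ f}

end

end RelAdv

/-!
Let `Γ` be a symmetric adversary matrix of `g` with norm `s > 0`, and let `α`, `β` be unit vectors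
supported on the two fibres of `g` with `⟪α, Γ β⟫ = s`. Symmetry costs nothing: since `Γ` maps each
fibre to the other one, one of its two blocks already attains the norm, and may replace the other.
The matrix `R = 1 + s⁻¹ Γ` is positive semidefinite, hence of the form `Cᵀ C`, and
`⟪α, R α⟫ = ⟪α, R β⟫ = ⟪β, R β⟫ = 1`.

A solution `u`, `v`, `σ` for `f ∘ g ^ N` yields one for `f`: for an outer input `z`, superpose the
vectors at all inner inputs `X`, weighted by the product of the coordinates of `α` or `β` (chosen
according to `z p`) at `X p`, and labelled by the columns of tensor powers of `C`. Inner products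
then average the constraints at `(X, Y)` against weights of total mass `1`. For the bit `q` of the
block `p`, the label of `v` has `Γ ⊙ D q` in place of `C` as its factor at `p`, and that of `u` has
`1`; as `R ⊙ D q = s⁻¹ (Γ ⊙ D q)`, this recovers the `D q`-part of `R` up to the factor `s`. As `Γ`
vanishes on pairs in the same fibre, the coordinates with `z p = w p` do not contribute. As
`‖Γ ⊙ D q‖ ≤ 1`, neither cost increases, and rescaling by `s⁻¹` gains the factor `s`.
-/

namespace RelAdv

open Matrix
open scoped RealInnerProductSpace

section RelationalBound

variable {n K : ℕ} {f : Set (Cube n × Fin K)}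

theorem relCost_nonneg {d : ℕ} (u v : Cube n → Fin n → EuclideanSpace ℝ (Fin d)) :
    0 ≤ relCost u v :=
  le_max_of_le_left <| Real.iSup_nonneg fun _ => Finset.sum_nonneg fun _ _ => sq_nonneg _

theorem sum_norm_sq_left_le_relCost {d : ℕ} (u v : Cube n → Fin n → EuclideanSpace ℝ (Fin d))
    (x : Cube n) : ∑ i, ‖u x i‖ ^ 2 ≤ relCost u v :=
  le_max_of_le_left <| le_ciSup (f := fun x => ∑ i, ‖u x i‖ ^ 2) (Set.finite_range _).bddAbove x

theorem sum_norm_sq_right_le_relCost {d : ℕ} (u v : Cube n → Fin n → EuclideanSpace ℝ (Fin d))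
    (x : Cube n) : ∑ i, ‖v x i‖ ^ 2 ≤ relCost u v :=
  le_max_of_le_right <| le_ciSup (f := fun x => ∑ i, ‖v x i‖ ^ 2) (Set.finite_range _).bddAbove x

theorem advRel_nonneg (f : Set (Cube n × Fin K)) : 0 ≤ advRel f :=
  Real.sInf_nonneg <| by rintro _ ⟨_, _, u, v, _, _, rfl⟩; exact relCost_nonneg u v

theorem advRel_le_relCost {d e : ℕ} {u v : Cube n → Fin n → EuclideanSpace ℝ (Fin d)}
    {σ : Cube n → Fin K → EuclideanSpace ℝ (Fin e)} (h : IsRelFeasible f u v σ) :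
    advRel f ≤ relCost u v :=
  csInf_le ⟨0, by rintro _ ⟨_, _, u, v, _, _, rfl⟩; exact relCost_nonneg u v⟩
    ⟨d, e, u, v, σ, h, rfl⟩

section InnerProductSpace

variable {E F : Type*} [NormedAddCommGroup E] [InnerProductSpace ℝ E] [FiniteDimensional ℝ E]
  [NormedAddCommGroup F] [InnerProductSpace ℝ F] [FiniteDimensional ℝ F]
  {u v : Cube n → Fin n → E} {σ : Cube n → Fin K → F}

theorem exists_isRelFeasible_of_innerProductSpace
    (hsum : ∀ x y, ∑ i with x i ≠ y i, ⟪u x i, v y i⟫ = 1 - ∑ a, ⟪σ x a, σ y a⟫)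
    (hσ : ∀ x a, (x, a) ∉ f → σ x a = 0) :
    ∃ (d e : ℕ) (u' v' : Cube n → Fin n → EuclideanSpace ℝ (Fin d))
      (σ' : Cube n → Fin K → EuclideanSpace ℝ (Fin e)), IsRelFeasible f u' v' σ' ∧
      (∀ x i, ‖u' x i‖ = ‖u x i‖) ∧ ∀ x i, ‖v' x i‖ = ‖v x i‖ := by
  let φ := (stdOrthonormalBasis ℝ E).repr
  let ψ := (stdOrthonormalBasis ℝ F).repr
  refine ⟨_, _, fun x i => φ (u x i), fun x i => φ (v x i), fun x a => ψ (σ x a),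
    ⟨fun x y => ?_, fun x a hxa => ?_⟩, fun x i => φ.norm_map _, fun x i => φ.norm_map _⟩
  · simpa only [LinearIsometryEquiv.inner_map_map] using hsum x y
  · simp [hσ x a hxa]

theorem advRel_mul_le_of_innerProductSpace {c B : ℝ} (hc : 0 < c)
    (hsum : ∀ x y, ∑ i with x i ≠ y i, c⁻¹ * ⟪u x i, v y i⟫ = 1 - ∑ a, ⟪σ x a, σ y a⟫)
    (hσ : ∀ x a, (x, a) ∉ f → σ x a = 0) (hu : ∀ x, ∑ i, ‖u x i‖ ^ 2 ≤ B)
    (hv : ∀ x, ∑ i, ‖v x i‖ ^ 2 ≤ B) : advRel f * c ≤ B := by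
  have hsqrt : √c⁻¹ * √c⁻¹ = c⁻¹ := Real.mul_self_sqrt (inv_nonneg.2 hc.le)
  have hcost {a : Fin n → E} (ha : ∑ i, ‖a i‖ ^ 2 ≤ B) : ∑ i, ‖√c⁻¹ • a i‖ ^ 2 ≤ B / c := by
    simp only [norm_smul, mul_pow, Real.norm_eq_abs, sq_abs, sq √c⁻¹, hsqrt, ← Finset.mul_sum]
    rw [div_eq_inv_mul]
    gcongr
  obtain ⟨d, e, u', v', σ', h, hu', hv'⟩ := exists_isRelFeasible_of_innerProductSpace
    (u := fun x i => √c⁻¹ • u x i) (v := fun x i => √c⁻¹ • v x i) (σ := σ) (f := f)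
    (fun x y => by
      simpa only [real_inner_smul_left, real_inner_smul_right, ← mul_assoc, hsqrt] using hsum x y)
    hσ
  rw [← le_div_iff₀ hc]
  refine (advRel_le_relCost h).trans (max_le (ciSup_le fun x => ?_) (ciSup_le fun x => ?_))
  · simpa only [hu'] using hcost (hu x)
  · simpa only [hv'] using hcost (hv x)

end InnerProductSpace

theorem exists_isRelFeasible (hf : ∀ x, ∃ a, (x, a) ∈ f) :
    ∃ (d e : ℕ) (u v : Cube n → Fin n → EuclideanSpace ℝ (Fin d))
      (σ : Cube n → Fin K → EuclideanSpace ℝ (Fin e)), IsRelFeasible f u v σ := by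
  choose a ha using hf
  let u : Cube n → Fin n → EuclideanSpace ℝ (Cube n) := fun x _ => EuclideanSpace.single x 1
  -- The constraint at `x ≠ y` has `hammingDist x y` summands, which must add up to `1`.
  let v : Cube n → Fin n → EuclideanSpace ℝ (Cube n) := fun y _ =>
    WithLp.toLp 2 fun x => (hammingDist x y : ℝ)⁻¹
  let σ : Cube n → Fin K → EuclideanSpace ℝ (Cube n) := fun x b =>
    if b = a x then EuclideanSpace.single x 1 else 0
  have hleft (x y : Cube n) : ∑ i with x i ≠ y i, ⟪u x i, v y i⟫ = if x = y then 0 else 1 := by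
    have hinner (i : Fin n) : ⟪u x i, v y i⟫ = (hammingDist x y : ℝ)⁻¹ := by
      simp [u, v, EuclideanSpace.inner_single_left]
    calc ∑ i with x i ≠ y i, ⟪u x i, v y i⟫
        = hammingDist x y * (hammingDist x y : ℝ)⁻¹ := by
          simp only [hinner, Finset.sum_const, nsmul_eq_mul, hammingDist]
      _ = if x = y then 0 else 1 := by
          split_ifs with hxy
          · simp [hxy]
          · exact mul_inv_cancel₀ (Nat.cast_ne_zero.2 (hammingDist_ne_zero.2 hxy))
  have hright (x y : Cube n) : ∑ b, ⟪σ x b, σ y b⟫ = if x = y then 1 else 0 := by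
    by_cases hxy : x = y
    · simp [σ, hxy, apply_ite]
    · rw [if_neg hxy]
      refine Finset.sum_eq_zero fun b _ => ?_
      simp only [σ]
      split_ifs <;> simp [EuclideanSpace.inner_single_left, hxy]
  obtain ⟨d, e, u', v', σ', h, -⟩ := exists_isRelFeasible_of_innerProductSpace
    (u := u) (v := v) (σ := σ) (f := f)
    (fun x y => by rw [hleft, hright]; split_ifs <;> norm_num)
    (fun x b hxb => if_neg fun hb : b = a x => hxb (hb ▸ ha x))
  exact ⟨d, e, u', v', σ', h⟩

end RelationalBound

section SpectralNorm

variable {ι : Type*} [Fintype ι] [DecidableEq ι]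

theorem specNorm_nonneg (M : Matrix ι ι ℝ) : 0 ≤ specNorm M := norm_nonneg _

theorem specNorm_one_le : specNorm (1 : Matrix ι ι ℝ) ≤ 1 := by
  rw [specNorm, map_one]
  exact ContinuousLinearMap.norm_id_le

theorem specNorm_smul (c : ℝ) (M : Matrix ι ι ℝ) : specNorm (c • M) = |c| * specNorm M := by
  rw [specNorm, map_smul, norm_smul, Real.norm_eq_abs, specNorm]

theorem norm_toEuclideanCLM_le (M : Matrix ι ι ℝ) (v : EuclideanSpace ℝ ι) :
    ‖toEuclideanCLM (𝕜 := ℝ) M v‖ ≤ specNorm M * ‖v‖ :=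
  ContinuousLinearMap.le_opNorm _ _

open scoped Matrix.Norms.L2Operator in
theorem specNorm_transpose (M : Matrix ι ι ℝ) : specNorm Mᵀ = specNorm M :=
  l2_opNorm_conjTranspose M

open scoped Matrix.Norms.L2Operator in
theorem specNorm_transpose_mul_self (M : Matrix ι ι ℝ) :
    specNorm (Mᵀ * M) = specNorm M * specNorm M :=
  l2_opNorm_conjTranspose_mul_self M

theorem exists_norm_toEuclideanCLM_eq_specNorm (M : Matrix ι ι ℝ) :
    ∃ v : EuclideanSpace ℝ ι, ‖v‖ ≤ 1 ∧ ‖toEuclideanCLM (𝕜 := ℝ) M v‖ = specNorm M := by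
  obtain ⟨v, hv, hmax⟩ :=
    (isCompact_closedBall (0 : EuclideanSpace ℝ ι) 1).exists_sSup_image_eq
      (Metric.nonempty_closedBall.2 zero_le_one)
      (f := fun v => ‖toEuclideanCLM (𝕜 := ℝ) M v‖) (by fun_prop)
  exact ⟨v, mem_closedBall_zero_iff.1 hv,
    hmax.symm.trans (ContinuousLinearMap.sSup_unitClosedBall_eq_norm _)⟩

theorem posSemidef_one_add {S : Matrix ι ι ℝ} (hS : S.IsSymm) (hS1 : specNorm S ≤ 1) :
    (1 + S).PosSemidef := by
  refine .of_dotProduct_mulVec_nonneg ?_ fun v => ?_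
  · exact isHermitian_one.add (by rwa [IsHermitian, conjTranspose_eq_transpose_of_trivial])
  set x : EuclideanSpace ℝ ι := WithLp.toLp 2 v
  have hform : star v ⬝ᵥ (1 + S) *ᵥ v = ‖x‖ ^ 2 + ⟪x, toEuclideanCLM (𝕜 := ℝ) S x⟫ := by
    rw [star_trivial, ← real_inner_self_eq_norm_sq, ← inner_add_right,
      ← inner_toEuclideanCLM (1 + S) x x, map_add, map_one]
    rfl
  have hle : |⟪x, toEuclideanCLM (𝕜 := ℝ) S x⟫| ≤ ‖x‖ ^ 2 := by
    calc |⟪x, toEuclideanCLM (𝕜 := ℝ) S x⟫|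
        ≤ ‖x‖ * ‖toEuclideanCLM (𝕜 := ℝ) S x‖ := abs_real_inner_le_norm _ _
      _ ≤ ‖x‖ * (1 * ‖x‖) := by
          gcongr
          exact (norm_toEuclideanCLM_le S x).trans (by gcongr)
      _ = ‖x‖ ^ 2 := by ring
  rw [hform]
  linarith [neg_abs_le ⟪x, toEuclideanCLM (𝕜 := ℝ) S x⟫]

open scoped MatrixOrder in
theorem exists_transpose_mul_self_eq_one_add {S : Matrix ι ι ℝ} (hS : S.IsSymm)
    (hS1 : specNorm S ≤ 1) : ∃ C : Matrix ι ι ℝ, Cᵀ * C = 1 + S := by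
  obtain ⟨C, hC⟩ :=
    CStarAlgebra.nonneg_iff_eq_star_mul_self.1 (posSemidef_one_add hS hS1).nonneg
  exact ⟨C, by rw [hC, star_eq_conjTranspose, conjTranspose_eq_transpose_of_trivial]⟩

theorem exists_transpose_mul_self_add_eq_one {G : Matrix ι ι ℝ} (hG : specNorm G ≤ 1) :
    ∃ H : Matrix ι ι ℝ, Gᵀ * G + Hᵀ * H = 1 := by
  have hsymm : (-(Gᵀ * G)).IsSymm := by simp [IsSymm, transpose_mul]
  have hnorm : specNorm (-(Gᵀ * G)) ≤ 1 := by
    rw [← neg_one_smul ℝ, specNorm_smul, specNorm_transpose_mul_self, abs_neg, abs_one, one_mul]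
    exact mul_le_one₀ hG (specNorm_nonneg G) hG
  obtain ⟨H, hH⟩ := exists_transpose_mul_self_eq_one_add hsymm hnorm
  exact ⟨H, by rw [hH]; abel⟩

end SpectralNorm

section Fibers

variable {ι : Type*} {g : ι → Bool}

/-- The restriction of a vector to the fibre of `g` over `b`, extended by zero. -/
noncomputable def fiberPart (g : ι → Bool) (b : Bool) (v : EuclideanSpace ℝ ι) :
    EuclideanSpace ℝ ι :=
  WithLp.toLp 2 fun x => if g x = b then v x else 0

/-- A matrix is fibre-alternating when it vanishes on pairs of points in the same fibre of `g`:
this is the support condition of an adversary matrix. -/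
def IsFiberAlternating (g : ι → Bool) (M : Matrix ι ι ℝ) : Prop :=
  ∀ x y, g x = g y → M x y = 0

/-- The symmetric fibre-alternating matrix whose columns over `b` agree with those of `M` off the
fibre over `b`; the block of `M` with columns over `!b` is discarded. -/
def symmBlock (g : ι → Bool) (b : Bool) (M : Matrix ι ι ℝ) : Matrix ι ι ℝ :=
  of fun x y => if g x = g y then 0 else if g y = b then M x y else M y x

theorem isFiberAlternating_symmBlock (b : Bool) (M : Matrix ι ι ℝ) :
    IsFiberAlternating g (symmBlock g b M) :=
  fun _ _ hxy => if_pos hxy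

theorem isSymm_symmBlock (b : Bool) (M : Matrix ι ι ℝ) : (symmBlock g b M).IsSymm := by
  ext x y
  simp only [transpose_apply, symmBlock, of_apply]
  cases b <;> cases g x <;> cases g y <;> rfl

theorem symmBlock_not_transpose (b : Bool) (M : Matrix ι ι ℝ) :
    symmBlock g (!b) Mᵀ = symmBlock g b M := by
  ext x y
  simp only [transpose_apply, symmBlock, of_apply]
  cases b <;> cases g x <;> cases g y <;> rfl

theorem symmBlock_hadamard (b : Bool) (M : Matrix ι ι ℝ) {D : Matrix ι ι ℝ} (hD : D.IsSymm) :
    symmBlock g b (M ⊙ D) = symmBlock g b M ⊙ D := by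
  ext x y
  simp only [symmBlock, of_apply, hadamard_apply, hD.apply x y]
  split_ifs <;> simp

theorem fiberPart_fiberPart (b : Bool) (v : EuclideanSpace ℝ ι) :
    fiberPart g b (fiberPart g b v) = fiberPart g b v := by
  ext x
  by_cases hx : g x = b <;> simp [fiberPart, hx]

theorem fiberPart_smul (b : Bool) (c : ℝ) (v : EuclideanSpace ℝ ι) :
    fiberPart g b (c • v) = c • fiberPart g b v := by
  ext x
  by_cases hx : g x = b <;> simp [fiberPart, hx]

theorem apply_eq_zero_of_fiberPart_eq {b : Bool} {v : EuclideanSpace ℝ ι}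
    (hv : fiberPart g b v = v) {x : ι} (hx : g x ≠ b) : v x = 0 := by
  rw [← hv]
  exact if_neg hx

variable [Fintype ι]

theorem inner_eq_zero_of_fiberPart_eq {b : Bool} {v w : EuclideanSpace ℝ ι}
    (hv : fiberPart g b v = v) (hw : fiberPart g (!b) w = w) : ⟪v, w⟫ = 0 := by
  rw [PiLp.inner_apply]
  refine Finset.sum_eq_zero fun x _ => ?_
  by_cases hx : g x = b
  · simp [apply_eq_zero_of_fiberPart_eq hw (x := x) (by simp [hx])]
  · simp [apply_eq_zero_of_fiberPart_eq hv hx]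

theorem norm_sq_fiberPart_add (b : Bool) (v : EuclideanSpace ℝ ι) :
    ‖fiberPart g b v‖ ^ 2 + ‖fiberPart g (!b) v‖ ^ 2 = ‖v‖ ^ 2 := by
  simp only [EuclideanSpace.real_norm_sq_eq, ← Finset.sum_add_distrib]
  refine Finset.sum_congr rfl fun x _ => ?_
  simp only [fiberPart]
  cases b <;> cases g x <;> simp

theorem norm_fiberPart_le (b : Bool) (v : EuclideanSpace ℝ ι) : ‖fiberPart g b v‖ ≤ ‖v‖ :=
  (sq_le_sq₀ (norm_nonneg _) (norm_nonneg _)).1 <| by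
    linarith [norm_sq_fiberPart_add (g := g) b v, sq_nonneg ‖fiberPart g (!b) v‖]

variable [DecidableEq ι]

theorem IsFiberAlternating.toEuclideanCLM_fiberPart {M : Matrix ι ι ℝ}
    (hM : IsFiberAlternating g M) (b : Bool) (v : EuclideanSpace ℝ ι) :
    toEuclideanCLM (𝕜 := ℝ) M (fiberPart g b v) =
      fiberPart g (!b) (toEuclideanCLM (𝕜 := ℝ) M v) := by
  ext x
  simp only [fiberPart, toEuclideanCLM_toLp, ofLp_toEuclideanCLM, mulVec, dotProduct]
  by_cases hx : g x = !b
  · rw [if_pos hx]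
    refine Finset.sum_congr rfl fun y _ => ?_
    have := hM x y
    cases b <;> cases hy : g y <;> simp_all
  · rw [if_neg hx]
    refine Finset.sum_eq_zero fun y _ => ?_
    have := hM x y
    cases b <;> cases hy : g y <;> simp_all

theorem IsFiberAlternating.norm_sq_toEuclideanCLM {M : Matrix ι ι ℝ}
    (hM : IsFiberAlternating g M) (b : Bool) (v : EuclideanSpace ℝ ι) :
    ‖toEuclideanCLM (𝕜 := ℝ) M v‖ ^ 2 = ‖toEuclideanCLM (𝕜 := ℝ) M (fiberPart g b v)‖ ^ 2 +
      ‖toEuclideanCLM (𝕜 := ℝ) M (fiberPart g (!b) v)‖ ^ 2 := by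
  rw [hM.toEuclideanCLM_fiberPart, hM.toEuclideanCLM_fiberPart, add_comm, Bool.not_not,
    norm_sq_fiberPart_add]

theorem toEuclideanCLM_symmBlock_fiberPart (b : Bool) (M : Matrix ι ι ℝ)
    (v : EuclideanSpace ℝ ι) :
    toEuclideanCLM (𝕜 := ℝ) (symmBlock g b M) (fiberPart g b v) =
      fiberPart g (!b) (toEuclideanCLM (𝕜 := ℝ) M (fiberPart g b v)) := by
  ext x
  simp only [fiberPart, toEuclideanCLM_toLp, mulVec, dotProduct, symmBlock, of_apply]
  split_ifs with hx
  · refine Finset.sum_congr rfl fun y _ => ?_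
    cases b <;> cases hy : g y <;> simp_all
  · refine Finset.sum_eq_zero fun y _ => ?_
    cases b <;> cases hy : g y <;> simp_all

theorem norm_toEuclideanCLM_symmBlock_fiberPart_le (b : Bool) (M : Matrix ι ι ℝ)
    (v : EuclideanSpace ℝ ι) :
    ‖toEuclideanCLM (𝕜 := ℝ) (symmBlock g b M) (fiberPart g b v)‖ ≤
      specNorm M * ‖fiberPart g b v‖ := by
  rw [toEuclideanCLM_symmBlock_fiberPart]
  exact (norm_fiberPart_le _ _).trans (norm_toEuclideanCLM_le _ _)

theorem specNorm_symmBlock_le (b : Bool) (M : Matrix ι ι ℝ) :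
    specNorm (symmBlock g b M) ≤ specNorm M := by
  refine ContinuousLinearMap.opNorm_le_bound _ (specNorm_nonneg M) fun v => ?_
  refine le_of_sq_le_sq ?_ (mul_nonneg (specNorm_nonneg M) (norm_nonneg v))
  have hb := norm_toEuclideanCLM_symmBlock_fiberPart_le (g := g) b M v
  have hnb := norm_toEuclideanCLM_symmBlock_fiberPart_le (g := g) (!b) Mᵀ v
  rw [symmBlock_not_transpose, specNorm_transpose] at hnb
  calc ‖toEuclideanCLM (𝕜 := ℝ) (symmBlock g b M) v‖ ^ 2
      = ‖toEuclideanCLM (𝕜 := ℝ) (symmBlock g b M) (fiberPart g b v)‖ ^ 2 +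
        ‖toEuclideanCLM (𝕜 := ℝ) (symmBlock g b M) (fiberPart g (!b) v)‖ ^ 2 :=
        (isFiberAlternating_symmBlock b M).norm_sq_toEuclideanCLM b v
    _ ≤ (specNorm M * ‖fiberPart g b v‖) ^ 2 + (specNorm M * ‖fiberPart g (!b) v‖) ^ 2 := by
        gcongr
    _ = (specNorm M * ‖v‖) ^ 2 := by
        rw [mul_pow, mul_pow, mul_pow, ← mul_add, norm_sq_fiberPart_add]

theorem IsFiberAlternating.exists_fiber_norm_eq_specNorm {M : Matrix ι ι ℝ}
    (hM : IsFiberAlternating g M) (hpos : 0 < specNorm M) :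
    ∃ (b : Bool) (β : EuclideanSpace ℝ ι), fiberPart g b β = β ∧ ‖β‖ = 1 ∧
      ‖toEuclideanCLM (𝕜 := ℝ) M β‖ = specNorm M := by
  obtain ⟨v, hv, hMv⟩ := exists_norm_toEuclideanCLM_eq_specNorm M
  have hle (b : Bool) : ‖toEuclideanCLM (𝕜 := ℝ) M (fiberPart g b v)‖ ^ 2 ≤
      specNorm M ^ 2 * ‖fiberPart g b v‖ ^ 2 := by
    rw [← mul_pow]
    gcongr
    exact norm_toEuclideanCLM_le M _
  have heq (b : Bool) : ‖toEuclideanCLM (𝕜 := ℝ) M (fiberPart g b v)‖ =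
      specNorm M * ‖fiberPart g b v‖ := by
    have hsum := hM.norm_sq_toEuclideanCLM b v
    have hv2 : specNorm M ^ 2 * (‖fiberPart g b v‖ ^ 2 + ‖fiberPart g (!b) v‖ ^ 2) ≤
        specNorm M ^ 2 := by
      rw [norm_sq_fiberPart_add]
      exact mul_le_of_le_one_right (sq_nonneg _) (pow_le_one₀ (norm_nonneg v) hv)
    rw [← sq_eq_sq₀ (norm_nonneg _) (mul_nonneg hpos.le (norm_nonneg _)), mul_pow]
    rw [hMv] at hsum
    linarith [hle b, hle !b]
  obtain ⟨b, hb⟩ : ∃ b, fiberPart g b v ≠ 0 := by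
    by_contra! h0
    have hMv2 := hM.norm_sq_toEuclideanCLM true v
    simp only [h0, map_zero, norm_zero, hMv] at hMv2
    exact hpos.ne' (by simpa using hMv2)
  refine ⟨b, ‖fiberPart g b v‖⁻¹ • fiberPart g b v, ?_, norm_smul_inv_norm hb, ?_⟩
  · rw [fiberPart_smul, fiberPart_fiberPart]
  · rw [map_smul, norm_smul, heq, norm_inv, norm_norm, mul_left_comm,
      inv_mul_cancel₀ (norm_ne_zero_iff.2 hb), mul_one]

end Fibers

section Attaining

variable {ι : Type*} [Fintype ι] [DecidableEq ι] {g : ι → Bool}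

theorem specNorm_symmBlock_eq {M : Matrix ι ι ℝ} (hM : IsFiberAlternating g M) {b : Bool}
    {β : EuclideanSpace ℝ ι} (hβ : fiberPart g b β = β) (hβ1 : ‖β‖ = 1)
    (hMβ : ‖toEuclideanCLM (𝕜 := ℝ) M β‖ = specNorm M) :
    specNorm (symmBlock g b M) = specNorm M := by
  refine (specNorm_symmBlock_le b M).antisymm ?_
  have happly : toEuclideanCLM (𝕜 := ℝ) (symmBlock g b M) β = toEuclideanCLM (𝕜 := ℝ) M β := by
    rw [← hβ, toEuclideanCLM_symmBlock_fiberPart, ← hM.toEuclideanCLM_fiberPart, hβ, hβ]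
  calc specNorm M = ‖toEuclideanCLM (𝕜 := ℝ) (symmBlock g b M) β‖ := by rw [happly, hMβ]
    _ ≤ specNorm (symmBlock g b M) := by
      simpa [hβ1] using norm_toEuclideanCLM_le (symmBlock g b M) β

/-- The matrix `1 + ‖Γ‖⁻¹ Γ`. For symmetric `Γ` it is the Gram matrix of the labels of the
superpositions built below; it is `1` when `Γ = 0`. -/
noncomputable def normalizedGram (Γ : Matrix ι ι ℝ) : Matrix ι ι ℝ :=
  1 + (specNorm Γ)⁻¹ • Γ

theorem exists_transpose_mul_self_eq_normalizedGram {Γ : Matrix ι ι ℝ} (hΓ : Γ.IsSymm) :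
    ∃ C : Matrix ι ι ℝ, Cᵀ * C = normalizedGram Γ := by
  refine exists_transpose_mul_self_eq_one_add (hΓ.smul _) ?_
  rw [specNorm_smul, abs_of_nonneg (inv_nonneg.2 (specNorm_nonneg Γ))]
  exact inv_mul_le_one

theorem IsFiberAlternating.normalizedGram_apply {Γ : Matrix ι ι ℝ}
    (hΓ : IsFiberAlternating g Γ) {x y : ι} (hxy : g x = g y) :
    normalizedGram Γ x y = (1 : Matrix ι ι ℝ) x y := by
  simp [normalizedGram, hΓ x y hxy]

/-- A pair of unit vectors, one supported on each fibre of `g`, on which the bilinear form of `R`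
takes the value `1` on all pairs. For `R = normalizedGram Γ` these are the two halves of a vector
at which `Γ` attains its norm. -/
structure IsAttainingPair (g : ι → Bool) (R : Matrix ι ι ℝ) (δ : Bool → EuclideanSpace ℝ ι) :
    Prop where
  apply_eq_zero : ∀ b x, g x ≠ b → δ b x = 0
  norm_eq_one : ∀ b, ‖δ b‖ = 1
  inner_eq_one : ∀ b c, ⟪δ b, toEuclideanCLM (𝕜 := ℝ) R (δ c)⟫ = 1

theorem inner_toEuclideanCLM_comm {M : Matrix ι ι ℝ} (hM : M.IsSymm)
    (v w : EuclideanSpace ℝ ι) :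
    ⟪v, toEuclideanCLM (𝕜 := ℝ) M w⟫ = ⟪w, toEuclideanCLM (𝕜 := ℝ) M v⟫ := by
  have hstar : star M = M := by
    rw [star_eq_conjTranspose, conjTranspose_eq_transpose_of_trivial, hM.eq]
  have hadj : (toEuclideanCLM (𝕜 := ℝ) M).adjoint = toEuclideanCLM (𝕜 := ℝ) M := by
    rw [← ContinuousLinearMap.star_eq_adjoint, ← map_star, hstar]
  rw [← ContinuousLinearMap.adjoint_inner_left, hadj, real_inner_comm]

theorem IsFiberAlternating.inner_toEuclideanCLM_self {M : Matrix ι ι ℝ}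
    (hM : IsFiberAlternating g M) {b : Bool} {v : EuclideanSpace ℝ ι}
    (hv : fiberPart g b v = v) : ⟪v, toEuclideanCLM (𝕜 := ℝ) M v⟫ = 0 :=
  inner_eq_zero_of_fiberPart_eq hv <| by
    rw [← hv, hM.toEuclideanCLM_fiberPart, fiberPart_fiberPart]

theorem IsFiberAlternating.exists_inner_eq_specNorm {M : Matrix ι ι ℝ}
    (hM : IsFiberAlternating g M) (hpos : 0 < specNorm M) :
    ∃ (b : Bool) (α β : EuclideanSpace ℝ ι), fiberPart g b β = β ∧ fiberPart g (!b) α = α ∧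
      ‖β‖ = 1 ∧ ‖α‖ = 1 ∧ ⟪α, toEuclideanCLM (𝕜 := ℝ) M β⟫ = specNorm M := by
  obtain ⟨b, β, hβ, hβ1, hMβ⟩ := hM.exists_fiber_norm_eq_specNorm hpos
  refine ⟨b, (specNorm M)⁻¹ • toEuclideanCLM (𝕜 := ℝ) M β, β, hβ, ?_, hβ1, ?_, ?_⟩
  · rw [← hβ, hM.toEuclideanCLM_fiberPart, fiberPart_smul, fiberPart_fiberPart]
  · rw [norm_smul, hMβ, norm_inv, Real.norm_of_nonneg hpos.le, inv_mul_cancel₀ hpos.ne']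
  · rw [real_inner_smul_left, real_inner_self_eq_norm_sq, hMβ, sq,
      inv_mul_cancel_left₀ hpos.ne']

theorem inner_toEuclideanCLM_normalizedGram (Γ : Matrix ι ι ℝ) (v w : EuclideanSpace ℝ ι) :
    ⟪v, toEuclideanCLM (𝕜 := ℝ) (normalizedGram Γ) w⟫ =
      ⟪v, w⟫ + (specNorm Γ)⁻¹ * ⟪v, toEuclideanCLM (𝕜 := ℝ) Γ w⟫ := by
  rw [normalizedGram, map_add, map_one, map_smul, ← real_inner_smul_right, ← inner_add_right]
  rfl

theorem IsFiberAlternating.exists_isAttainingPair {Γ : Matrix ι ι ℝ}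
    (hΓ : IsFiberAlternating g Γ) (hsymm : Γ.IsSymm) (hpos : 0 < specNorm Γ) :
    ∃ δ, IsAttainingPair g (normalizedGram Γ) δ := by
  obtain ⟨b, α, β, hβ, hα, hβ1, hα1, hαβ⟩ := hΓ.exists_inner_eq_specNorm hpos
  have horth : ⟪β, α⟫ = 0 := inner_eq_zero_of_fiberPart_eq hβ hα
  have hβα : ⟪β, toEuclideanCLM (𝕜 := ℝ) Γ α⟫ = specNorm Γ := by
    rw [inner_toEuclideanCLM_comm hsymm, hαβ]
  refine ⟨fun c => if c = b then β else α, fun c x hx => ?_, fun c => ?_, fun c c' => ?_⟩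
  · split_ifs with hc
    · exact apply_eq_zero_of_fiberPart_eq hβ (hc ▸ hx)
    · exact apply_eq_zero_of_fiberPart_eq hα (Bool.eq_not_of_ne hc ▸ hx)
  · split_ifs <;> assumption
  · rw [inner_toEuclideanCLM_normalizedGram]
    split_ifs
    · rw [real_inner_self_eq_norm_sq, hβ1, hΓ.inner_toEuclideanCLM_self hβ]; norm_num
    · rw [horth, hβα, inv_mul_cancel₀ hpos.ne', zero_add]
    · rw [real_inner_comm, horth, hαβ, inv_mul_cancel₀ hpos.ne', zero_add]
    · rw [real_inner_self_eq_norm_sq, hα1, hΓ.inner_toEuclideanCLM_self hα]; norm_num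

end Attaining

section PiKronecker

variable {ι β R : Type*} [Fintype ι] [CommSemiring R]

/-- The Kronecker product of a finite family of square matrices. -/
def piKronecker (A : ι → Matrix β β R) : Matrix (ι → β) (ι → β) R :=
  of fun X Y => ∏ p, A p (X p) (Y p)

theorem transpose_piKronecker_mul_piKronecker [DecidableEq ι] [Fintype β]
    (A B : ι → Matrix β β R) :
    (piKronecker A)ᵀ * piKronecker B = piKronecker fun p => (A p)ᵀ * B p := by
  ext X Y
  simp only [mul_apply, transpose_apply, piKronecker, of_apply, ← Finset.prod_mul_distrib,
    Fintype.prod_sum]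

theorem piKronecker_apply_eq_one_apply [DecidableEq β] {A : ι → Matrix β β R}
    {X Y : ι → β} (h : ∀ p, A p (X p) (Y p) = (1 : Matrix β β R) (X p) (Y p)) :
    piKronecker A X Y = (1 : Matrix (ι → β) (ι → β) R) X Y := by
  classical
  simp only [piKronecker, of_apply, h, one_apply, Fintype.prod_ite_zero, funext_iff,
    Finset.prod_const_one]

/-- The Kronecker product whose factor at `p` is `A` and whose other factors are `C`. -/
def piKroneckerAt [DecidableEq ι] (C : Matrix β β R) (p : ι) (A : Matrix β β R) :
    Matrix (ι → β) (ι → β) R :=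
  piKronecker (Function.update (fun _ => C) p A)

variable [DecidableEq ι]

theorem piKroneckerAt_apply (C : Matrix β β R) (p : ι) (A : Matrix β β R) (X Y : ι → β) :
    piKroneckerAt C p A X Y =
      A (X p) (Y p) * ∏ r ∈ Finset.univ.erase p, C (X r) (Y r) := by
  rw [piKroneckerAt, piKronecker, of_apply, ← Finset.mul_prod_erase _ _ (Finset.mem_univ p),
    Function.update_self]
  congr 1
  refine Finset.prod_congr rfl fun r hr => ?_
  rw [Function.update_of_ne (Finset.ne_of_mem_erase hr)]

theorem piKroneckerAt_add (C : Matrix β β R) (p : ι) (A B : Matrix β β R) :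
    piKroneckerAt C p (A + B) = piKroneckerAt C p A + piKroneckerAt C p B := by
  ext X Y
  simp only [Matrix.add_apply, piKroneckerAt_apply, add_mul]

theorem transpose_piKroneckerAt_mul_piKroneckerAt [Fintype β] (C : Matrix β β R) (p : ι)
    (A B : Matrix β β R) :
    (piKroneckerAt C p A)ᵀ * piKroneckerAt C p B = piKroneckerAt (Cᵀ * C) p (Aᵀ * B) := by
  rw [piKroneckerAt, piKroneckerAt, transpose_piKronecker_mul_piKronecker, piKroneckerAt]
  congr 1
  ext1 r
  by_cases hr : r = p
  · subst hr; simp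
  · simp [hr]

end PiKronecker

section Superposition

variable {S T E : Type*} [Fintype S] [NormedAddCommGroup E] [InnerProductSpace ℝ E]

/-- The superposition `∑ x, w x • (F e_x) ⊗ a x` of the vectors `a x`, with weights `w x` and the
columns of `F` as labels; the tensor product is encoded as a family of vectors. -/
noncomputable def superpose (F : Matrix T S ℝ) (w : S → ℝ) (a : S → E) : PiLp 2 fun _ : T => E :=
  WithLp.toLp 2 fun t => ∑ x, (w x * F t x) • a x

theorem inner_superpose [Fintype T] (F H : Matrix T S ℝ) (w k : S → ℝ) (a b : S → E) :
    ⟪superpose F w a, superpose H k b⟫ =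
      ∑ x, ∑ y, w x * k y * (Fᵀ * H) x y * ⟪a x, b y⟫ := by
  simp only [PiLp.inner_apply, superpose, sum_inner]
  simp only [inner_sum, real_inner_smul_left, real_inner_smul_right]
  rw [Finset.sum_comm]
  refine Finset.sum_congr rfl fun x _ => ?_
  rw [Finset.sum_comm]
  refine Finset.sum_congr rfl fun y _ => ?_
  rw [mul_apply, Finset.mul_sum, Finset.sum_mul]
  exact Finset.sum_congr rfl fun t _ => by rw [transpose_apply]; ring

theorem norm_sq_superpose_add_eq [Fintype T] {F G H : Matrix T S ℝ}
    (h : Fᵀ * F + Gᵀ * G = Hᵀ * H) (w : S → ℝ) (a : S → E) :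
    ‖superpose F w a‖ ^ 2 + ‖superpose G w a‖ ^ 2 = ‖superpose H w a‖ ^ 2 := by
  simp only [← real_inner_self_eq_norm_sq, inner_superpose, ← h, Matrix.add_apply, mul_add,
    add_mul, Finset.sum_add_distrib]

variable {ι α : Type*} [Fintype ι] [DecidableEq ι] [Fintype α] [DecidableEq α]

theorem norm_sq_superpose_piKroneckerAt_le {G : Matrix α α ℝ} (hG : specNorm G ≤ 1)
    (C : Matrix α α ℝ) (p : ι) (w : (ι → α) → ℝ) (a : (ι → α) → E) :
    ‖superpose (piKroneckerAt C p G) w a‖ ^ 2 ≤ ‖superpose (piKroneckerAt C p 1) w a‖ ^ 2 := by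
  obtain ⟨H, hH⟩ := exists_transpose_mul_self_add_eq_one hG
  have hadd : (piKroneckerAt C p G)ᵀ * piKroneckerAt C p G +
      (piKroneckerAt C p H)ᵀ * piKroneckerAt C p H =
      (piKroneckerAt C p 1)ᵀ * piKroneckerAt C p 1 := by
    simp only [transpose_piKroneckerAt_mul_piKroneckerAt, ← piKroneckerAt_add, hH, transpose_one,
      mul_one]
  rw [← norm_sq_superpose_add_eq hadd]
  exact le_add_of_nonneg_right (sq_nonneg _)

end Superposition

section ProductWeights

variable {ι α : Type*} [Fintype ι] {g : α → Bool} {R : Matrix α α ℝ}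
  {δ : Bool → EuclideanSpace ℝ α}

/-- The coordinate at `X` of the tensor product of the vectors `δ (z p)`. -/
def prodWeight (δ : Bool → EuclideanSpace ℝ α) (z : ι → Bool) (X : ι → α) : ℝ :=
  ∏ p, δ (z p) (X p)

variable [Fintype α] [DecidableEq α]

theorem IsAttainingPair.eq_of_prodWeight_ne_zero (h : IsAttainingPair g R δ) {z : ι → Bool}
    {X : ι → α} (hX : prodWeight δ z X ≠ 0) (p : ι) : g (X p) = z p := by
  by_contra hp
  exact hX (Finset.prod_eq_zero (Finset.mem_univ p) (h.apply_eq_zero _ _ hp))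

variable [DecidableEq ι]

theorem IsAttainingPair.sum_prodWeight_sq (h : IsAttainingPair g R δ) (z : ι → Bool) :
    ∑ X, prodWeight δ z X ^ 2 = 1 := by
  calc ∑ X, prodWeight δ z X ^ 2 = ∏ p, ∑ x, δ (z p) x ^ 2 := by
        simp only [prodWeight, ← Finset.prod_pow, Fintype.prod_sum]
    _ = 1 := Finset.prod_eq_one fun p _ => by
        rw [← EuclideanSpace.real_norm_sq_eq, h.norm_eq_one, one_pow]

theorem IsAttainingPair.sum_prodWeight_mul_piKronecker (h : IsAttainingPair g R δ)
    (z w : ι → Bool) :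
    ∑ X, ∑ Y, prodWeight δ z X * prodWeight δ w Y * piKronecker (fun _ => R) X Y = 1 := by
  calc ∑ X, ∑ Y, prodWeight δ z X * prodWeight δ w Y * piKronecker (fun _ => R) X Y
      = ∏ p, ∑ x, ∑ y, δ (z p) x * δ (w p) y * R x y := by
        simp only [prodWeight, piKronecker, of_apply, ← Finset.prod_mul_distrib, Fintype.prod_sum]
    _ = ∏ p, ⟪δ (z p), toEuclideanCLM (𝕜 := ℝ) R (δ (w p))⟫ := by
        refine Finset.prod_congr rfl fun p _ => ?_
        simp only [PiLp.inner_apply, ofLp_toEuclideanCLM, mulVec, dotProduct, RCLike.inner_apply,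
          conj_trivial, Finset.sum_mul]
        exact Finset.sum_congr rfl fun x _ => Finset.sum_congr rfl fun y _ => by ring
    _ = 1 := Finset.prod_eq_one fun p _ => h.inner_eq_one _ _

/-- The labels of nonzero weight are orthonormal, as their blocks lie in the fibres prescribed by
`z`. -/
theorem IsAttainingPair.norm_sq_superpose_piKroneckerAt_one {E : Type*} [NormedAddCommGroup E]
    [InnerProductSpace ℝ E] (h : IsAttainingPair g R δ) {C : Matrix α α ℝ}
    (hC : ∀ x y, g x = g y → (Cᵀ * C) x y = (1 : Matrix α α ℝ) x y) (p : ι) (z : ι → Bool)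
    (a : (ι → α) → E) :
    ‖superpose (piKroneckerAt C p 1) (prodWeight δ z) a‖ ^ 2 =
      ∑ X, prodWeight δ z X ^ 2 * ‖a X‖ ^ 2 := by
  have hone (X Y : ι → α) (hX : prodWeight δ z X ≠ 0) (hY : prodWeight δ z Y ≠ 0) :
      piKroneckerAt (Cᵀ * C) p 1 X Y = (1 : Matrix (ι → α) (ι → α) ℝ) X Y := by
    refine piKronecker_apply_eq_one_apply fun r => ?_
    by_cases hr : r = p
    · rw [hr, Function.update_self]
    · rw [Function.update_of_ne hr]
      exact hC _ _ (by rw [h.eq_of_prodWeight_ne_zero hX, h.eq_of_prodWeight_ne_zero hY])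
  rw [← real_inner_self_eq_norm_sq, inner_superpose, transpose_piKroneckerAt_mul_piKroneckerAt,
    transpose_one, mul_one]
  refine Finset.sum_congr rfl fun X _ => ?_
  by_cases hX : prodWeight δ z X = 0
  · simp [hX]
  have hterm (Y : ι → α) : prodWeight δ z X * prodWeight δ z Y *
      piKroneckerAt (Cᵀ * C) p 1 X Y * ⟪a X, a Y⟫ =
      if X = Y then prodWeight δ z X * prodWeight δ z Y * ⟪a X, a Y⟫ else 0 := by
    by_cases hY : prodWeight δ z Y = 0
    · simp [hY]
    · simp [hone X Y hX hY, one_apply]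
  simp only [hterm, Finset.sum_ite_eq, Finset.mem_univ, if_true, real_inner_self_eq_norm_sq, sq]

end ProductWeights

section Composition

variable {N m K : ℕ}

/-- The string with blocks `X p`: the inverse of `block`. -/
def glue (X : Fin N → Cube m) : Cube (N * m) :=
  fun i => X (finProdFinEquiv.symm i).1 (finProdFinEquiv.symm i).2

theorem glue_finProdFinEquiv (X : Fin N → Cube m) (p : Fin N) (q : Fin m) :
    glue X (finProdFinEquiv (p, q)) = X p q := by
  simp [glue]

theorem block_glue (X : Fin N → Cube m) (p : Fin N) : block (glue X) p = X p :=
  funext fun q => glue_finProdFinEquiv X p q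

theorem glue_mem_compRel_iff {f : Set (Cube N × Fin K)} {g : Cube m → Bool} {X : Fin N → Cube m}
    {a : Fin K} : (glue X, a) ∈ compRel f g ↔ (fun p => g (X p), a) ∈ f := by
  simp [compRel, block_glue]

theorem sum_blocks (c : Fin (N * m) → ℝ) :
    ∑ p, ∑ q, c (finProdFinEquiv (p, q)) = ∑ i, c i := by
  rw [← finProdFinEquiv.sum_comp, Fintype.sum_prod_type]

theorem IsRelFeasible.sum_glue_eq {f : Set (Cube (N * m) × Fin K)} {d e : ℕ}
    {u v : Cube (N * m) → Fin (N * m) → EuclideanSpace ℝ (Fin d)}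
    {σ : Cube (N * m) → Fin K → EuclideanSpace ℝ (Fin e)} (h : IsRelFeasible f u v σ)
    (X Y : Fin N → Cube m) :
    ∑ p, ∑ q, diffMatrix q (X p) (Y p) *
      ⟪u (glue X) (finProdFinEquiv (p, q)), v (glue Y) (finProdFinEquiv (p, q))⟫ =
      1 - ∑ a, ⟪σ (glue X) a, σ (glue Y) a⟫ := by
  rw [← h.sum_eq, Finset.sum_filter, ← sum_blocks]
  simp only [glue_finProdFinEquiv, diffMatrix, of_apply, ite_mul, one_mul, zero_mul]

theorem isSymm_diffMatrix (q : Fin m) : (diffMatrix q).IsSymm := by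
  ext x y
  simp only [transpose_apply, diffMatrix, of_apply, ne_comm]

variable {g : Cube m → Bool} {Γ C : Matrix (Cube m) (Cube m) ℝ}

theorem IsAdvFeasible.isFiberAlternating (hΓ : IsAdvFeasible g Γ) : IsFiberAlternating g Γ :=
  hΓ.eq_zero

theorem IsAdvFeasible.exists_isSymm (hΓ : IsAdvFeasible g Γ) (hpos : 0 < specNorm Γ) :
    ∃ Γ', IsAdvFeasible g Γ' ∧ Γ'.IsSymm ∧ specNorm Γ' = specNorm Γ := by
  obtain ⟨b, β, hβ, hβ1, hΓβ⟩ := hΓ.isFiberAlternating.exists_fiber_norm_eq_specNorm hpos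
  refine ⟨symmBlock g b Γ, ⟨fun q => ?_, isFiberAlternating_symmBlock b Γ⟩,
    isSymm_symmBlock b Γ, specNorm_symmBlock_eq hΓ.isFiberAlternating hβ hβ1 hΓβ⟩
  rw [← symmBlock_hadamard b Γ (isSymm_diffMatrix q)]
  exact (specNorm_symmBlock_le b _).trans (hΓ.norm_le q)

theorem normalizedGram_mul_diffMatrix (Γ : Matrix (Cube m) (Cube m) ℝ) (q : Fin m)
    (x y : Cube m) : normalizedGram Γ x y * diffMatrix q x y =
      (specNorm Γ)⁻¹ * (Γ ⊙ diffMatrix q) x y := by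
  by_cases hxy : x = y
  · simp [hxy, diffMatrix]
  · simp [normalizedGram, one_apply_ne hxy, mul_assoc]

theorem piKronecker_normalizedGram_mul_diffMatrix (Γ : Matrix (Cube m) (Cube m) ℝ) (p : Fin N)
    (q : Fin m) (X Y : Fin N → Cube m) :
    piKronecker (fun _ => normalizedGram Γ) X Y * diffMatrix q (X p) (Y p) =
      (specNorm Γ)⁻¹ * piKroneckerAt (normalizedGram Γ) p (Γ ⊙ diffMatrix q) X Y := by
  have hself : piKronecker (fun _ : Fin N => normalizedGram Γ) =
      piKroneckerAt (normalizedGram Γ) p (normalizedGram Γ) := by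
    rw [piKroneckerAt, Function.update_eq_self p fun _ => normalizedGram Γ]
  rw [hself, piKroneckerAt_apply, piKroneckerAt_apply, mul_right_comm,
    normalizedGram_mul_diffMatrix, mul_assoc]

variable {E : Type*} [NormedAddCommGroup E] [InnerProductSpace ℝ E]

/-- The vector at the outer coordinate `p` assembled from the vectors `c (glue X) i` of all bits
`i` in block `p`: the bit `q` contributes a superposition over `X` whose labels have the factor
`G q` in block `p` and the factor `C` elsewhere. -/
noncomputable def outerVec (C : Matrix (Cube m) (Cube m) ℝ) (w : (Fin N → Cube m) → ℝ) (p : Fin N)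
    (G : Fin m → Matrix (Cube m) (Cube m) ℝ) (c : Cube (N * m) → Fin (N * m) → E) :
    PiLp 2 fun _ : Fin m => PiLp 2 fun _ : Fin N → Cube m => E :=
  WithLp.toLp 2 fun q =>
    superpose (piKroneckerAt C p (G q)) w fun X => c (glue X) (finProdFinEquiv (p, q))

theorem inner_outerVec_one (hC : Cᵀ * C = normalizedGram Γ) (w k : (Fin N → Cube m) → ℝ)
    (p : Fin N) (G : Fin m → Matrix (Cube m) (Cube m) ℝ)
    (u v : Cube (N * m) → Fin (N * m) → E) :
    ⟪outerVec C w p (fun _ => 1) u, outerVec C k p G v⟫ =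
      ∑ q, ∑ X, ∑ Y, w X * k Y * piKroneckerAt (normalizedGram Γ) p (G q) X Y *
        ⟪u (glue X) (finProdFinEquiv (p, q)), v (glue Y) (finProdFinEquiv (p, q))⟫ := by
  simp only [outerVec, PiLp.inner_apply]
  simp only [← PiLp.inner_apply, inner_superpose, transpose_piKroneckerAt_mul_piKroneckerAt,
    transpose_one, one_mul, hC]

variable {δ : Bool → EuclideanSpace ℝ (Cube m)}

theorem sum_norm_sq_outerVec_le (hΓ : IsFiberAlternating g Γ)
    (hC : Cᵀ * C = normalizedGram Γ) (hδ : IsAttainingPair g (normalizedGram Γ) δ)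
    {G : Fin m → Matrix (Cube m) (Cube m) ℝ} (hG : ∀ q, specNorm (G q) ≤ 1)
    {c : Cube (N * m) → Fin (N * m) → E} {B : ℝ} (hB : ∀ x, ∑ i, ‖c x i‖ ^ 2 ≤ B)
    (z : Cube N) : ∑ p, ‖outerVec C (prodWeight δ z) p G c‖ ^ 2 ≤ B := by
  have hterm (p : Fin N) : ‖outerVec C (prodWeight δ z) p G c‖ ^ 2 ≤
      ∑ q, ∑ X, prodWeight δ z X ^ 2 * ‖c (glue X) (finProdFinEquiv (p, q))‖ ^ 2 := by
    rw [outerVec, PiLp.norm_sq_eq_of_L2]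
    refine Finset.sum_le_sum fun q _ => ?_
    rw [← hδ.norm_sq_superpose_piKroneckerAt_one (C := C) (p := p) fun x y hxy => by
      rw [hC, hΓ.normalizedGram_apply hxy]]
    exact norm_sq_superpose_piKroneckerAt_le (hG q) C p _ _
  calc ∑ p, ‖outerVec C (prodWeight δ z) p G c‖ ^ 2
      ≤ ∑ p, ∑ q, ∑ X, prodWeight δ z X ^ 2 * ‖c (glue X) (finProdFinEquiv (p, q))‖ ^ 2 :=
        Finset.sum_le_sum fun p _ => hterm p
    _ = ∑ X, prodWeight δ z X ^ 2 * ∑ i, ‖c (glue X) i‖ ^ 2 := by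
        rw [sum_blocks fun i => ∑ X, prodWeight δ z X ^ 2 * ‖c (glue X) i‖ ^ 2, Finset.sum_comm]
        simp only [Finset.mul_sum]
    _ ≤ ∑ X, prodWeight δ z X ^ 2 * B := by
        gcongr with X
        exact hB _
    _ = B := by rw [← Finset.sum_mul, hδ.sum_prodWeight_sq, one_mul]

theorem inner_outerVec_eq_zero (hΓ : IsFiberAlternating g Γ) (hC : Cᵀ * C = normalizedGram Γ)
    (hδ : IsAttainingPair g (normalizedGram Γ) δ) {z w : Cube N} {p : Fin N} (hzw : z p = w p)
    (u v : Cube (N * m) → Fin (N * m) → E) :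
    ⟪outerVec C (prodWeight δ z) p (fun _ => 1) u,
      outerVec C (prodWeight δ w) p (fun q => Γ ⊙ diffMatrix q) v⟫ = 0 := by
  rw [inner_outerVec_one hC]
  refine Finset.sum_eq_zero fun q _ => Finset.sum_eq_zero fun X _ =>
    Finset.sum_eq_zero fun Y _ => ?_
  by_cases hX : prodWeight δ z X = 0
  · simp [hX]
  by_cases hY : prodWeight δ w Y = 0
  · simp [hY]
  have hg : g (X p) = g (Y p) := by
    rw [hδ.eq_of_prodWeight_ne_zero hX, hδ.eq_of_prodWeight_ne_zero hY, hzw]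
  simp [piKroneckerAt_apply, hΓ _ _ hg]

theorem inv_specNorm_mul_inner_outerVec (hC : Cᵀ * C = normalizedGram Γ)
    (w k : (Fin N → Cube m) → ℝ) (p : Fin N) (u v : Cube (N * m) → Fin (N * m) → E) :
    (specNorm Γ)⁻¹ * ⟪outerVec C w p (fun _ => 1) u,
      outerVec C k p (fun q => Γ ⊙ diffMatrix q) v⟫ =
      ∑ X, ∑ Y, w X * k Y * piKronecker (fun _ => normalizedGram Γ) X Y *
        ∑ q, diffMatrix q (X p) (Y p) *
          ⟪u (glue X) (finProdFinEquiv (p, q)), v (glue Y) (finProdFinEquiv (p, q))⟫ := by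
  rw [inner_outerVec_one hC, Finset.sum_comm, Finset.mul_sum]
  refine Finset.sum_congr rfl fun X _ => ?_
  rw [Finset.sum_comm, Finset.mul_sum]
  refine Finset.sum_congr rfl fun Y _ => ?_
  rw [Finset.mul_sum, Finset.mul_sum]
  refine Finset.sum_congr rfl fun q _ => ?_
  linear_combination -(w X * k Y *
    ⟪u (glue X) (finProdFinEquiv (p, q)), v (glue Y) (finProdFinEquiv (p, q))⟫) *
    piKronecker_normalizedGram_mul_diffMatrix Γ p q X Y

/-- The vector for the outer answer `a` assembled from the vectors `c (glue X) a`: a superposition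
over `X` with label factors `C` in every block. -/
noncomputable def answerVec (C : Matrix (Cube m) (Cube m) ℝ) (w : (Fin N → Cube m) → ℝ)
    (c : Cube (N * m) → Fin K → E) (a : Fin K) : PiLp 2 fun _ : Fin N → Cube m => E :=
  superpose (piKronecker fun _ => C) w fun X => c (glue X) a

theorem sum_inner_answerVec (hC : Cᵀ * C = normalizedGram Γ) (w k : (Fin N → Cube m) → ℝ)
    (σ : Cube (N * m) → Fin K → E) :
    ∑ a, ⟪answerVec C w σ a, answerVec C k σ a⟫ =
      ∑ X, ∑ Y, w X * k Y * piKronecker (fun _ => normalizedGram Γ) X Y *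
        ∑ a, ⟪σ (glue X) a, σ (glue Y) a⟫ := by
  simp only [answerVec, inner_superpose, transpose_piKronecker_mul_piKronecker, hC]
  rw [Finset.sum_comm]
  refine Finset.sum_congr rfl fun X _ => ?_
  rw [Finset.sum_comm]
  simp only [Finset.mul_sum]

theorem answerVec_eq_zero {R : Matrix (Cube m) (Cube m) ℝ} (hδ : IsAttainingPair g R δ)
    {f : Set (Cube N × Fin K)} {σ : Cube (N * m) → Fin K → E}
    (hσ : ∀ x a, (x, a) ∉ compRel f g → σ x a = 0) {z : Cube N} {a : Fin K} (hza : (z, a) ∉ f) :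
    answerVec C (prodWeight δ z) σ a = 0 := by
  have hterm (X : Fin N → Cube m) (c : ℝ) : (prodWeight δ z X * c) • σ (glue X) a = 0 := by
    by_cases hX : prodWeight δ z X = 0
    · simp [hX]
    have hz : (fun p => g (X p)) = z := funext (hδ.eq_of_prodWeight_ne_zero hX)
    rw [hσ _ _ (by rwa [glue_mem_compRel_iff, hz]), smul_zero]
  ext T
  simp [answerVec, superpose, hterm]

theorem IsRelFeasible.sum_inner_outerVec_eq {f : Set (Cube (N * m) × Fin K)} {d e : ℕ}
    {u v : Cube (N * m) → Fin (N * m) → EuclideanSpace ℝ (Fin d)}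
    {σ : Cube (N * m) → Fin K → EuclideanSpace ℝ (Fin e)} (h : IsRelFeasible f u v σ)
    (hΓ : IsFiberAlternating g Γ) (hC : Cᵀ * C = normalizedGram Γ)
    (hδ : IsAttainingPair g (normalizedGram Γ) δ) (z w : Cube N) :
    ∑ p with z p ≠ w p, (specNorm Γ)⁻¹ * ⟪outerVec C (prodWeight δ z) p (fun _ => 1) u,
      outerVec C (prodWeight δ w) p (fun q => Γ ⊙ diffMatrix q) v⟫ =
      1 - ∑ a, ⟪answerVec C (prodWeight δ z) σ a, answerVec C (prodWeight δ w) σ a⟫ := by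
  rw [Finset.sum_filter_of_ne fun p _ => mt fun hzw => by
    rw [inner_outerVec_eq_zero hΓ hC hδ hzw, mul_zero]]
  simp only [inv_specNorm_mul_inner_outerVec hC]
  rw [sum_inner_answerVec hC, ← hδ.sum_prodWeight_mul_piKronecker z w, ← Finset.sum_sub_distrib,
    Finset.sum_comm]
  refine Finset.sum_congr rfl fun X _ => ?_
  rw [← Finset.sum_sub_distrib, Finset.sum_comm]
  refine Finset.sum_congr rfl fun Y _ => ?_
  rw [← Finset.mul_sum, h.sum_glue_eq]
  ring

theorem advRel_mul_specNorm_le {f : Set (Cube N × Fin K)} (hΓ : IsAdvFeasible g Γ) {d e : ℕ}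
    {u v : Cube (N * m) → Fin (N * m) → EuclideanSpace ℝ (Fin d)}
    {σ : Cube (N * m) → Fin K → EuclideanSpace ℝ (Fin e)}
    (h : IsRelFeasible (compRel f g) u v σ) : advRel f * specNorm Γ ≤ relCost u v := by
  obtain hzero | hpos := (specNorm_nonneg Γ).eq_or_lt
  · rw [← hzero, mul_zero]
    exact relCost_nonneg u v
  obtain ⟨Γ, hΓ, hsymm, hnorm⟩ := hΓ.exists_isSymm hpos
  rw [← hnorm] at hpos ⊢
  have halt := hΓ.isFiberAlternating
  obtain ⟨C, hC⟩ := exists_transpose_mul_self_eq_normalizedGram hsymm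
  obtain ⟨δ, hδ⟩ := halt.exists_isAttainingPair hsymm hpos
  exact advRel_mul_le_of_innerProductSpace hpos (h.sum_inner_outerVec_eq halt hC hδ)
    (fun z a => answerVec_eq_zero hδ fun x b hxb => by simpa using h.norm_sq_eq_zero x b hxb)
    (sum_norm_sq_outerVec_le halt hC hδ (fun _ => specNorm_one_le)
      (sum_norm_sq_left_le_relCost u v))
    (sum_norm_sq_outerVec_le halt hC hδ hΓ.norm_le (sum_norm_sq_right_le_relCost u v))

end Composition

end RelAdv

theorem mainTheorem2 {N K m : ℕ} (f : Set (RelAdv.Cube N × Fin K))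
    (hf : ∀ x, ∃ a, (x, a) ∈ f) (g : RelAdv.Cube m → Bool) :
    RelAdv.advRel f * RelAdv.adv g ≤ RelAdv.advRel (RelAdv.compRel f g) := by
  obtain ⟨d, e, u, v, σ, h⟩ := RelAdv.exists_isRelFeasible (f := RelAdv.compRel f g) fun x =>
    hf fun p => g (RelAdv.block x p)
  rw [RelAdv.adv, ← smul_eq_mul, ← Real.sSup_smul_of_nonneg (RelAdv.advRel_nonneg f)]
  refine Real.sSup_le ?_ (RelAdv.advRel_nonneg _)
  rintro _ ⟨_, ⟨Γ, hΓ, rfl⟩, rfl⟩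
  refine le_csInf ⟨_, d, e, u, v, σ, h, rfl⟩ ?_
  rintro _ ⟨d, e, u, v, σ, h, rfl⟩
  exact RelAdv.advRel_mul_specNorm_le hΓ h
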